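/- \textbf{The functor $\mathcal F$.} Let $\mathtt{Ass}=\Delta^{\mathrm{op}}$, and let $\Delta_{\mathtt{Ass}}$ be its category of simplices: an object is a functor $\sigma:[k]\to\Delta^{\mathrm{op}}$ with $k\ge 0$, given by objects $\sigma_i=[n_i]$ and maps $f_i:[n_{i+1}]\to[n_i]$ of $\Delta$ ($0\le i<k$), and a morphism $\sigma\to\tau$, where $\tau:[l]\to\Delta^{\mathrm{op}}$, is a map $\alpha:[k]\to[l]$ of $\Delta$ with $\tau\circ\alpha=\sigma$. Hinich's functor $\mathcal F:\Delta_{\mathtt{Ass}}\to\mathbf{Cat}$ is described as follows. The objects of $\mathcal F(\sigma)$ are the symbols $\mathbf x^i_j,\mathbf y^i_j$ with $0\le i\le k$ and $1\le j\le n_i$ (one pair for each elementary segment $[j-1,j]\subseteq\sigma_i$), and $\mathcal F(\sigma)$ is the partially ordered set (equivalently, the free category on the graph) generated by the following arrows, for $0\le i<k$ and $1\le j\le n_{i+1}$, where $a=f_i(j-1)\le b=f_i(j)$: if $a<b$, \[\mathbf x^{i+1}_j\to\mathbf x^i_{a+1},\qquad \mathbf y^i_{m}\to\mathbf x^i_{m+1}\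 \ (a<m<b),\qquad \mathbf y^i_b\to\mathbf y^{i+1}_j ,\] and, if $a=b$, $\mathbf x^{i+1}_j\to\mathbf y^{i+1}_j$. A morphism $\alpha:\sigma\to\tau$ induces $\mathbf x^i_j\mapsto\mathbf x^{\alpha(i)}_j$, $\mathbf y^i_j\mapsto\mathbf y^{\alpha(i)}_j$. \textbf{Proposition.} Let $\mathbf S$ be the $\infty$-category of spaces and let $B\mathcal F:\Delta_{\mathtt{Ass}}\to\mathbf S$ be the composite of $\mathcal F$ with the groupoid completion (classifying space) functor $\mathbf{Cat}\to\mathbf S$. The automorphism group of $B\mathcal F$ in the $\infty$-category $\mathrm{Fun}(\Delta_{\mathtt{Ass}},\mathbf S)$ is trivial: every automorphism of $B\mathcal F$ is homotopic to the identity, and moreover the whole space $\mathrm{Aut}(B\mathcal F)$ of automorphisms is contractible. -/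

import Mathlib

open CategoryTheory MonoidalCategory CartesianMonoidalCategory

namespace HinichUnicity

/-! ### The category of simplices of the associative operad -/

/-- The associative (planar) operad `Ass = Δᵒᵖ`. -/
abbrev Ass : Type := SimplexCategoryᵒᵖ

/-- The category `Δ_Ass` of simplices of `Ass`: the comma category of the inclusion
`Δ ⊆ Cat` over `Ass`. Its objects are the functors `σ : [k] ⥤ Ass`; since `Ass` has no
non-identity isomorphisms, this is also the comma category in the 2-categorical sense. -/
abbrev SimplicesAss : Type := CostructuredArrow SimplexCategory.toCat (Cat.of Ass)

/-- The dimension `k` of a simplex `σ : [k] ⥤ Ass`. -/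
abbrev dim (σ : SimplicesAss) : ℕ := σ.left.len

/-- The vertex `σ_i`, viewed as an object of `Δ`. -/
def vertex (σ : SimplicesAss) (i : Fin (dim σ + 1)) : SimplexCategory :=
  (σ.hom.toFunctor.obj i).unop

/-- The edge `σ_i ⟶ σ_i'` of `Ass`, viewed as a morphism `σ_i' ⟶ σ_i` of `Δ`. -/
def edge (σ : SimplicesAss) {i i' : Fin (dim σ + 1)} (h : i ≤ i') :
    vertex σ i' ⟶ vertex σ i :=
  (σ.hom.toFunctor.map (homOfLE (X := Fin (dim σ + 1)) h)).unop

/-! ### The graphs attached to 0-simplices and 1-simplices -/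

/-- The two labels `𝐱` and `𝐲`. -/
inductive Label : Type
  | x
  | y

/-- The set `{[1] ⊆ [n]} × {𝐱, 𝐲}` attached to a 0-simplex `[n]`; the segment with index `j`
is the one from the vertex `j` to the vertex `j + 1`. -/
abbrev Pt (n : SimplexCategory) : Type := Fin n.len × Label

/-- The arrows of the graph attached to a 1-simplex `[m] ⟶ [n]` of `Ass`, dual to the map
`f : [n] ⟶ [m]` of `Δ`. Its set of vertices is the disjoint union of `Pt m` (the top row,
`Sum.inl`) and `Pt n` (the bottom row, `Sum.inr`).

The segment `j` of `[n]` pulls back to the convex subset `[a, b]` of `[m]`, where `a = f j` and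
`b = f (j + 1)`, with the segments `a, …, b - 1`. The arrows over `j` are
`𝐱_j ⟶ 𝐱_a`, `𝐲_a ⟶ 𝐱_{a+1}`, …, `𝐲_{b-2} ⟶ 𝐱_{b-1}`, `𝐲_{b-1} ⟶ 𝐲_j` if `a < b`, and
`𝐱_j ⟶ 𝐲_j` if `a = b`. The points over the segments of `[m]` that lie in no such convex subset
are isolated. -/
inductive Arc {n m : SimplexCategory} (f : n ⟶ m) : Pt m ⊕ Pt n → Pt m ⊕ Pt n → Prop
  | up (j : Fin n.len) (e : Fin m.len)
      (he : (e : ℕ) = f.toOrderHom j.castSucc) (hlt : (e : ℕ) < f.toOrderHom j.succ) :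
      Arc f (.inr (j, .x)) (.inl (e, .x))
  | across (j : Fin n.len) (e e' : Fin m.len)
      (he : (f.toOrderHom j.castSucc : ℕ) ≤ e) (hee' : (e' : ℕ) = e + 1)
      (hlt : (e' : ℕ) < f.toOrderHom j.succ) :
      Arc f (.inl (e, .y)) (.inl (e', .x))
  | down (j : Fin n.len) (e : Fin m.len)
      (he : (f.toOrderHom j.castSucc : ℕ) ≤ e) (hlt : (e : ℕ) + 1 = f.toOrderHom j.succ) :
      Arc f (.inl (e, .y)) (.inr (j, .y))
  | unit (j : Fin n.len) (h : f.toOrderHom j.castSucc = f.toOrderHom j.succ) :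
      Arc f (.inr (j, .x)) (.inr (j, .y))

/-! ### The functor `F` -/

/-- The set `F₀(σ)`, the disjoint union of the sets attached to the vertices of `σ`. -/
structure Obj (σ : SimplicesAss) : Type where
  level : Fin (dim σ + 1)
  seg : Fin (vertex σ level).len
  label : Label

/-- The inclusion of `Pt σ_i`. -/
def Obj.of (σ : SimplicesAss) (i : Fin (dim σ + 1)) (p : Pt (vertex σ i)) : Obj σ :=
  ⟨i, p.1, p.2⟩

/-- The arrows of the graph attached to `σ`: the union of the graphs attached to the
nearest-neighbour edges `σ_i ⟶ σ_{i+1}`, glued along the vertices of `σ`. -/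
inductive Step (σ : SimplicesAss) : Obj σ → Obj σ → Prop
  | mk (i : Fin (dim σ))
      (p q : Pt (vertex σ i.castSucc) ⊕ Pt (vertex σ i.succ))
      (h : Arc (edge σ i.castSucc_le_succ) p q) :
      Step σ (p.elim (Obj.of σ i.castSucc) (Obj.of σ i.succ))
        (q.elim (Obj.of σ i.castSucc) (Obj.of σ i.succ))

/-- The order on `F₀(σ)` generated by the graph. Every connected component of the graph is a
directed path (each point has at most one incoming and at most one outgoing arrow, and there
are no cycles), so this is the free category on the graph. -/
instance (σ : SimplicesAss) : Preorder (Obj σ) where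
  le := Relation.ReflTransGen (Step σ)
  le_refl _ := .refl
  le_trans _ _ _ := .trans

section Composition

variable {n₂ n₁ n₀ : SimplexCategory} {f : n₂ ⟶ n₁} {g : n₁ ⟶ n₀}
  {V : Type} [Preorder V] {v₀ : Pt n₀ → V} {v₁ : Pt n₁ → V} {v₂ : Pt n₂ → V}

lemma exists_crossing (h : ℕ → ℕ) (m a b : ℕ) (hab : a ≤ b) (ha : h a ≤ m) (hb : m < h b) :
    ∃ c, a ≤ c ∧ c < b ∧ h c ≤ m ∧ m < h (c + 1) := by
  induction b, hab using Nat.le_induction with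
  | base => omega
  | succ b hab ih =>
    by_cases hm : m < h b
    · obtain ⟨c, h1, h2, h3⟩ := ih hm
      exact ⟨c, h1, by omega, h3⟩
    · exact ⟨b, hab, by omega, by omega, hb⟩

/-- Each arrow attached to a composite is a composite of arrows attached to the factors. -/
lemma arc_comp
    (hf : ∀ p q, Arc f p q → p.elim v₁ v₂ ≤ q.elim v₁ v₂)
    (hg : ∀ p q, Arc g p q → p.elim v₀ v₁ ≤ q.elim v₀ v₁)
    (p q) (h : Arc (f ≫ g) p q) : p.elim v₀ v₂ ≤ q.elim v₀ v₂ := by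
  let G : ℕ → ℕ := fun k ↦ if hk : k < n₁.len + 1 then g.toOrderHom ⟨k, hk⟩ else 0
  have G_eq (k : Fin (n₁.len + 1)) : (g.toOrderHom k : ℕ) = G k := by
    simp only [G, k.is_lt, dite_true]
  have G_mono (k l : ℕ) (hkl : k ≤ l) (hl : l < n₁.len + 1) : G k ≤ G l := by
    have hk : k < n₁.len + 1 := by omega
    simp only [G, hl, hk, dite_true]
    exact g.toOrderHom.monotone hkl
  have comp_eq (k) : ((f ≫ g).toOrderHom k : ℕ) = G (f.toOrderHom k) := by
    rw [← G_eq]; rfl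
  have G_lt (k : ℕ) : G k < n₀.len + 1 := by
    dsimp [G]; split <;> omega
  have fle (j : Fin n₂.len) : (f.toOrderHom j.castSucc : ℕ) ≤ f.toOrderHom j.succ :=
    f.toOrderHom.monotone j.castSucc_le_succ
  have flt (j : Fin n₂.len) : (f.toOrderHom j.succ : ℕ) < n₁.len + 1 := Fin.is_lt _
  -- walking along degenerate segments
  have walk (j : Fin n₂.len) (c : ℕ) (hc : (f.toOrderHom j.castSucc : ℕ) ≤ c) (d : ℕ)
      (hcd : c ≤ d) (hd : d < f.toOrderHom j.succ) (hG : G c = G d) :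
      v₁ (⟨c, by have := flt j; omega⟩, .x) ≤ v₁ (⟨d, by have := flt j; omega⟩, .x) := by
    induction d, hcd using Nat.le_induction with
    | base => exact le_rfl
    | succ d hcd ih =>
      have hj := flt j
      have h1 := G_mono c d hcd (by omega)
      have h2 := G_mono d (d + 1) (by omega) (by omega)
      refine (ih (by omega) (by omega)).trans ?_
      refine (hg _ _ (.unit ⟨d, by omega⟩ ?_)).trans
        (hf _ _ (.across j ⟨d, by omega⟩ ⟨d + 1, by omega⟩ (by simpa using hc.trans hcd) rfl hd))
      apply Fin.ext
      rw [G_eq, G_eq]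
      simp only [Fin.val_castSucc, Fin.val_succ]
      omega
  cases h with
  | up j e he hlt =>
    rw [comp_eq] at he hlt
    have hj := flt j
    obtain ⟨c, hac, hcb, hc, hc'⟩ := exists_crossing G e _ _ (fle j) (by omega) hlt
    have h1 := G_mono _ _ hac (by omega)
    refine (hf _ _ (.up j ⟨f.toOrderHom j.castSucc, by omega⟩ rfl (by simp; omega))).trans ?_
    refine (walk j _ le_rfl c hac hcb (by omega)).trans ?_
    refine hg _ _ (.up ⟨c, by omega⟩ e ?_ ?_) <;> rw [G_eq] <;> simp <;> omega
  | across j e e' he hee' hlt =>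
    rw [comp_eq] at he hlt
    have hj := flt j
    obtain ⟨c, hac, hcb, hc, hc'⟩ := exists_crossing G e _ _ (fle j) he (by omega)
    by_cases hm : (e' : ℕ) < G (c + 1)
    · refine hg _ _ (.across ⟨c, by omega⟩ e e' ?_ hee' ?_) <;> rw [G_eq] <;> simp <;> omega
    · have hcb' : c + 1 < f.toOrderHom j.succ := by
        by_contra hcon
        have : c + 1 = f.toOrderHom j.succ := by omega
        rw [← this] at hlt
        omega
      obtain ⟨d, hcd, hdb, hd, hd'⟩ := exists_crossing G e' (c + 1) _ hcb'.le (by omega) hlt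
      have h1 := G_mono _ _ hcd (by omega)
      refine (hg (.inl (e, .y)) (.inr (⟨c, by omega⟩, .y)) (.down _ e ?_ ?_)).trans ?_
      · rw [G_eq]; simpa using hc
      · rw [G_eq]; simp; omega
      refine (hf (.inl (⟨c, by omega⟩, .y)) (.inl (⟨c + 1, by omega⟩, .x))
        (.across j _ _ (by simpa using hac) rfl hcb')).trans ?_
      refine (walk j (c + 1) (by omega) d hcd hdb (by omega)).trans ?_
      refine hg _ _ (.up ⟨d, by omega⟩ e' ?_ ?_) <;> rw [G_eq] <;> simp <;> omega
  | down j e he hlt =>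
    rw [comp_eq] at he hlt
    have hj := flt j
    obtain ⟨c, hac, hcb, hc, hc'⟩ := exists_crossing G e _ _ (fle j) he (by omega)
    have h1 := G_mono (c + 1) _ hcb (by omega)
    refine (hg (.inl (e, .y)) (.inr (⟨c, by omega⟩, .y)) (.down _ e ?_ ?_)).trans ?_
    · rw [G_eq]; simpa using hc
    · rw [G_eq]; simp; omega
    have hlast : v₁ (⟨(f.toOrderHom j.succ : ℕ) - 1, by omega⟩, .y) ≤ v₂ (j, .y) :=
      hf (.inl _) (.inr _) (.down j _ (by simp; omega) (by simp; omega))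
    refine le_trans ?_ hlast
    by_cases hcb' : c + 1 = f.toOrderHom j.succ
    · have : c = (f.toOrderHom j.succ : ℕ) - 1 := by omega
      subst this
      exact le_rfl
    · refine (hf (.inl (⟨c, by omega⟩, .y)) (.inl (⟨c + 1, by omega⟩, .x))
        (.across j _ _ (by simpa using hac) rfl (by simp; omega))).trans ?_
      have h2 := G_mono (c + 1) ((f.toOrderHom j.succ : ℕ) - 1) (by omega) (by omega)
      have h3 := G_mono ((f.toOrderHom j.succ : ℕ) - 1) _ (Nat.sub_le _ 1) (by omega)
      refine (walk j (c + 1) (by omega) ((f.toOrderHom j.succ : ℕ) - 1) (by omega) (by omega)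
        (by omega)).trans ?_
      refine hg (.inr _) (.inr _) (.unit ⟨(f.toOrderHom j.succ : ℕ) - 1, by omega⟩ ?_)
      apply Fin.ext
      rw [G_eq, G_eq]
      simp only [Fin.val_castSucc, Fin.val_succ]
      rw [show (f.toOrderHom j.succ : ℕ) - 1 + 1 = f.toOrderHom j.succ by omega]
      omega
  | unit j h =>
    have h := congrArg Fin.val h
    rw [comp_eq, comp_eq] at h
    have hj := flt j
    by_cases hab : f.toOrderHom j.castSucc = f.toOrderHom j.succ
    · exact hf _ _ (.unit j hab)
    · have hlt : (f.toOrderHom j.castSucc : ℕ) < f.toOrderHom j.succ :=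
        lt_of_le_of_ne (fle j) (fun h ↦ hab (Fin.ext h))
      have h2 := G_mono (f.toOrderHom j.castSucc) ((f.toOrderHom j.succ : ℕ) - 1) (by omega)
        (by omega)
      have h3 := G_mono ((f.toOrderHom j.succ : ℕ) - 1) _ (Nat.sub_le _ 1) (by omega)
      refine (hf _ _ (.up j ⟨f.toOrderHom j.castSucc, by omega⟩ rfl hlt)).trans ?_
      refine (walk j _ le_rfl ((f.toOrderHom j.succ : ℕ) - 1) (by omega) (by omega)
        (by omega)).trans ?_
      refine (hg (.inr _) (.inr _) (.unit ⟨(f.toOrderHom j.succ : ℕ) - 1, by omega⟩ ?_)).trans ?_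
      · apply Fin.ext
        rw [G_eq, G_eq]
        simp only [Fin.val_castSucc, Fin.val_succ]
        rw [show (f.toOrderHom j.succ : ℕ) - 1 + 1 = f.toOrderHom j.succ by omega]
        omega
      · exact hf (.inl _) (.inr _) (.down j _ (by simp; omega) (by simp; omega))

/-- The arrows attached to an identity do not relate distinct points of a vertex. -/
lemma arc_id {n : SimplexCategory} {V : Type} [Preorder V] (v : Pt n → V) (p q)
    (h : Arc (𝟙 n) p q) : p.elim v v ≤ q.elim v v := by
  cases h with
  | up j e he hlt => exact le_of_eq (congrArg (fun t ↦ v (t, .x)) (Fin.ext he.symm))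
  | across j e e' he hee' hlt => simp at he hlt; omega
  | down j e he hlt =>
    refine le_of_eq (congrArg (fun t ↦ v (t, .y)) (Fin.ext ?_))
    simpa using hlt
  | unit j h => simp [Fin.ext_iff] at h

end Composition

lemma edge_self (σ : SimplicesAss) (i : Fin (dim σ + 1)) : edge σ (le_refl i) = 𝟙 _ :=
  congrArg Quiver.Hom.unop (σ.hom.toFunctor.map_id i)

lemma edge_comp (σ : SimplicesAss) {i j k : Fin (dim σ + 1)} (h : i ≤ j) (h' : j ≤ k) :
    edge σ (h.trans h') = edge σ h' ≫ edge σ h :=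
  congrArg Quiver.Hom.unop (σ.hom.toFunctor.map_comp (homOfLE (X := Fin (dim σ + 1)) h)
    (homOfLE (X := Fin (dim σ + 1)) h'))

/-- The arrows attached to any edge of `σ` are respected by the order on `F₀(σ)`. -/
lemma arc_le (σ : SimplicesAss) {i i' : Fin (dim σ + 1)} (h : i ≤ i') (p q)
    (hpq : Arc (edge σ h) p q) :
    p.elim (Obj.of σ i) (Obj.of σ i') ≤ q.elim (Obj.of σ i) (Obj.of σ i') := by
  induction i' using Fin.induction with
  | zero =>
    obtain rfl : i = 0 := by simpa using h
    rw [edge_self] at hpq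
    exact arc_id _ _ _ hpq
  | succ k ih =>
    by_cases hi : i = k.succ
    · subst hi
      rw [edge_self] at hpq
      exact arc_id _ _ _ hpq
    · have hik : i ≤ k.castSucc := Fin.le_castSucc_iff.2 (lt_of_le_of_ne h hi)
      rw [edge_comp σ hik k.castSucc_le_succ] at hpq
      exact arc_comp (v₁ := Obj.of σ k.castSucc)
        (fun p q hpq ↦ Relation.ReflTransGen.single (.mk k p q hpq)) (fun p q hpq ↦ ih hik p q hpq) _ _ hpq

/-- The vertex map `[k] → [l]` underlying a morphism of `Δ_Ass`. -/
def levelMap {σ τ : SimplicesAss} (α : σ ⟶ τ) : Fin (dim σ + 1) →o Fin (dim τ + 1) :=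
  α.left.toOrderHom

lemma hom_eq {σ τ : SimplicesAss} (α : σ ⟶ τ) :
    σ.hom.toFunctor = (SimplexCategory.toCat.map α.left).toFunctor ⋙ τ.hom.toFunctor :=
  congrArg Cat.Hom.toFunctor (CostructuredArrow.w α).symm

lemma vertex_levelMap {σ τ : SimplicesAss} (α : σ ⟶ τ) (i : Fin (dim σ + 1)) :
    vertex σ i = vertex τ (levelMap α i) :=
  congrArg Opposite.unop (Functor.congr_obj (hom_eq α) i)

/-- The map `F₀(σ) → F₀(τ)` induced by a morphism `σ ⟶ τ` of `Δ_Ass`: it identifies the points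
over the vertex `σ_i` with the points over the vertex `τ_{α i} = σ_i`. -/
def Obj.map {σ τ : SimplicesAss} (α : σ ⟶ τ) (v : Obj σ) : Obj τ :=
  ⟨levelMap α v.level, v.seg.cast (congrArg SimplexCategory.len (vertex_levelMap α v.level)),
    v.label⟩

lemma arc_transport {n n' m m' : SimplexCategory} (hn : n = n') (hm : m = m')
    (f : n ⟶ m) (f' : n' ⟶ m') (hf : f = eqToHom hn ≫ f' ≫ eqToHom hm.symm)
    (p q) (h : Arc f p q) :
    Arc f'
      (p.map (Prod.map (Fin.cast (congrArg _ hm)) id) (Prod.map (Fin.cast (congrArg _ hn)) id))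
      (q.map (Prod.map (Fin.cast (congrArg _ hm)) id) (Prod.map (Fin.cast (congrArg _ hn)) id)) := by
  subst hn hm
  obtain rfl : f = f' := by simpa using hf
  have h1 : ∀ k : ℕ, (Prod.map (Fin.cast (rfl : k = k)) id : Fin k × Label → _) = id :=
    fun _ ↦ rfl
  simpa [h1] using h

lemma unop_map_eq {D : Type} [Category.{0} D] {S T : D ⥤ Ass} (e : S = T) {a b : D} (u : a ⟶ b)
    (ha : (S.obj b).unop = (T.obj b).unop) (hb : (T.obj a).unop = (S.obj a).unop) :
    (S.map u).unop = eqToHom ha ≫ (T.map u).unop ≫ eqToHom hb := by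
  subst e
  simp

lemma edge_levelMap {σ τ : SimplicesAss} (α : σ ⟶ τ) {i i' : Fin (dim σ + 1)} (h : i ≤ i') :
    edge σ h = eqToHom (vertex_levelMap α i') ≫ edge τ ((levelMap α).monotone h) ≫
      eqToHom (vertex_levelMap α i).symm :=
  unop_map_eq (hom_eq α) (homOfLE (X := Fin (dim σ + 1)) h) _ _

lemma Obj.map_monotone {σ τ : SimplicesAss} (α : σ ⟶ τ) : Monotone (Obj.map α) := by
  intro v w h
  induction h with
  | refl => exact le_rfl
  | tail _ hs ih =>
    refine ih.trans ?_
    obtain ⟨i, p, q, h⟩ := hs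
    have := arc_le τ _ _ _ (arc_transport (vertex_levelMap α _) (vertex_levelMap α _) _ _
      (edge_levelMap α i.castSucc_le_succ) _ _ h)
    rcases p with p | p <;> rcases q with q | q <;> exact this

/-- Hinich's functor `F : Δ_Ass ⥤ Cat`. It takes values in (finite) ordered sets. -/
def F : SimplicesAss ⥤ Cat.{0, 0} where
  obj σ := Cat.of (Obj σ)
  map α := (Obj.map_monotone α).functor.toCatHom
  map_id _ := congrArg Functor.toCatHom (CategoryTheory.Functor.ext (fun _ ↦ rfl)
    (fun _ _ _ ↦ rfl))
  map_comp _ _ := congrArg Functor.toCatHom (CategoryTheory.Functor.ext (fun _ ↦ rfl)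
    (fun _ _ _ ↦ rfl))

/-! ### Spaces -/

/-- The set of homotopy classes of maps `X ⟶ Z` (for `Z` a Kan complex). -/
def HomotopyClasses (X Z : SSet.{0}) : Type :=
  Quot fun f g : X ⟶ Z ↦ Nonempty (SSet.Homotopy f g)

/-- Precomposition on homotopy classes of maps. -/
def HomotopyClasses.precomp {X Y : SSet.{0}} (f : X ⟶ Y) (Z : SSet.{0}) :
    HomotopyClasses Y Z → HomotopyClasses X Z :=
  Quot.map (fun g ↦ f ≫ g) fun _ _ ⟨H⟩ ↦
    ⟨SSet.RelativeMorphism.Homotopy.precomp H (SSet.RelativeMorphism.botEquiv.symm f)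
      (Limits.IsInitial.hom_ext SSet.Subcomplex.isInitialBot _ _)⟩

/-- Weak homotopy equivalences of simplicial sets: the maps `f : X ⟶ Y` that induce bijections
`[Y, Z] → [X, Z]` for every Kan complex `Z`. The localization of `SSet` at this class is the
homotopy theory `𝐒` of spaces. -/
def weakEquivalences : MorphismProperty SSet.{0} := fun _ _ f ↦
  ∀ (Z : SSet.{0}) [SSet.KanComplex Z], Function.Bijective (HomotopyClasses.precomp f Z)

/-- The homotopy category of the ∞-category `Fun(C, 𝐒)` of functors from a (small) category `C`
to spaces: the localization of the category of `C`-diagrams of simplicial sets at the objectwise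
weak homotopy equivalences. -/
abbrev HoFun (C : Type) [Category.{0} C] :=
  (weakEquivalences.functorCategory C).Localization

/-- The object of `Fun(C, 𝐒)` presented by a diagram of simplicial sets. -/
abbrev toHoFun (C : Type) [Category.{0} C] : (C ⥤ SSet.{0}) ⥤ HoFun C :=
  (weakEquivalences.functorCategory C).Q

section AutomorphismSpace

variable {C : Type} [Category.{0} C]

/-- The product `K × D` of a simplicial set `K` and a diagram `D` (formed objectwise). It
presents the tensor of `D` by the space `K` in `Fun(C, 𝐒)`. -/
abbrev tensor (K : SSet.{0}) (D : C ⥤ SSet.{0}) : C ⥤ SSet.{0} := D ⋙ tensorLeft K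

/-- The projection `K × D ⟶ D`. -/
def tensorProj (K : SSet.{0}) (D : C ⥤ SSet.{0}) : tensor K D ⟶ D where
  app c := snd K (D.obj c)

/-- The inclusion `D ⟶ K × D` at a vertex `k` of `K`. -/
def tensorVertex {K : SSet.{0}} (k : K.obj (.op (.mk 0))) (D : C ⥤ SSet.{0}) :
    D ⟶ tensor K D where
  app c := lift (SSet.const k) (𝟙 (D.obj c))

/-- A `K`-family of automorphisms of `D` in `Fun(C, 𝐒)`, that is, a homotopy class of maps from
`K` to the space `Aut(D)`: a morphism `K × D ⟶ D` in the homotopy category whose restriction to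
each vertex of `K` is an isomorphism. -/
structure AutFamily (K : SSet.{0}) (D : C ⥤ SSet.{0}) where
  hom : (toHoFun C).obj (tensor K D) ⟶ (toHoFun C).obj D
  isIso (k : K.obj (.op (.mk 0))) : IsIso ((toHoFun C).map (tensorVertex k D) ≫ hom)

/-- The constant family at the identity, represented by the projection `K × D ⟶ D`. -/
def AutFamily.one (K : SSet.{0}) (D : C ⥤ SSet.{0}) : AutFamily K D where
  hom := (toHoFun C).map (tensorProj K D)
  isIso k := by
    have h : tensorVertex k D ≫ tensorProj K D = 𝟙 D := by
      ext c : 2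
      exact lift_snd _ _
    rw [← CategoryTheory.Functor.map_comp, h, CategoryTheory.Functor.map_id]
    infer_instance

/-- The space `Aut(D)` of automorphisms of `D` in the ∞-category `Fun(C, 𝐒)` is contractible:
for every `K`, the only homotopy class of maps `K → Aut(D)` is the constant one at the
identity. -/
def AutSpaceIsContractible (D : C ⥤ SSet.{0}) : Prop :=
  ∀ (K : SSet.{0}) (φ : AutFamily K D), φ = AutFamily.one K D

end AutomorphismSpace

/-- The functor `BF : Δ_Ass ⥤ 𝐒`, as a diagram of simplicial sets. The groupoid completion of a
category, an ∞-groupoid, is presented by the nerve of the category. -/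
def BF : SimplicesAss ⥤ SSet.{0} := F ⋙ nerveFunctor

end HinichUnicity

/-!
Everything reduces to connected components.

The arrows of the graph of `F(σ)` are determined by their source (`step_rightUnique`), so two
points of `F(σ)` in the same connected component have a common upper bound and, `F(σ)` being
finite, every component has an upper bound lying in it. The nerve of `F(σ)` is therefore
homotopy equivalent to the discrete simplicial set `π₀ BF(σ)`
(`weakEquivalences_toComponents_BF`).

The functor `π₀` inverts weak equivalences, because discrete simplicial sets are Kan complexes, and
the natural map `X ⟶ π₀ X` passes to the localization. By naturality of the latter, a morphism of
`Fun(C, 𝐒)` to a diagram that is objectwise equivalent to its `π₀` is determined by its effect on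
`π₀` (`hom_ext_of_components`). As `π₀ (K × D)` is covered by the copies of `π₀ D` at the vertices of
`K`, both claims follow once the diagram of sets `π₀ BF` has no endomorphism but the identity.

Let `θ` be an endomorphism of `π₀ BF` (`end_components_eq_id`). On `[1]` it acts on the two points
`𝐱, 𝐲`. Give each point of a simplex `[n]` its endpoint: `j` for the `𝐱` and `j + 1` for the `𝐲` of
the segment from `j` to `j + 1`. For a map `f : [n] ⟶ [m]`, points of `[m]` and of `[n]` that are
identified by the corresponding 1-simplex have endpoints matching under `f`. If `θ` sent `𝐱` to `𝐲`,
comparing the image of the first `𝐱` of `[2]` along the map `[1] ⟶ [2]` onto the extreme vertices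
and along the inclusion of the first segment would give it both endpoints `2` and `1`. Similarly
`θ` cannot send `𝐲` to `𝐱`. So `θ` fixes the points of `[1]`; along the inclusions of segments it
fixes all points of all `[n]`, and these cover `F(σ)` for every `σ`.
-/

namespace HinichUnicity

open Opposite Simplicial SSet

/-! ### Discrete simplicial sets and connected components -/

/-- The functor sending a set to the corresponding discrete simplicial set. -/
abbrev discrete : Type ⥤ SSet.{0} := Functor.const _

lemma discrete_app_map {X : SSet.{0}} {T : Type} (g : X ⟶ discrete.obj T)
    {n m : SimplexCategoryᵒᵖ} (φ : n ⟶ m) (x : X.obj n) :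
    (g.app m (X.map φ x) : T) = g.app n x :=
  ConcreteCategory.congr_hom (g.naturality φ) x

lemma discrete_app_stdSimplex {T : Type} {n : ℕ} (g : Δ[n] ⟶ discrete.obj T)
    {m : SimplexCategoryᵒᵖ} (x : (Δ[n] : SSet.{0}).obj m) :
    (g.app m x : T) = SSet.yonedaEquiv g := by
  refine Eq.trans ?_
    (discrete_app_map g (stdSimplex.objEquiv x).op (SSet.yonedaEquiv (𝟙 Δ[n])))
  congr 1
  exact (stdSimplex.objEquiv (n := ⦋n⦌)).injective (Category.comp_id _).symm

/-- Discrete simplicial sets are Kan complexes: the faces of a horn are constant, and any two of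
them meet. -/
instance kanComplex_discrete (T : Type) : KanComplex (discrete.obj T) := by
  rw [KanComplex.iff]
  intro n i f hf
  have key : ∀ j k (hj : j ≠ i) (hk : k ≠ i), j < k →
      SSet.yonedaEquiv (f j hj) = SSet.yonedaEquiv (f k hk) := by
    intro j k hj hk hjk
    obtain _ | n := n
    · omega
    · have h := congr_arg SSet.yonedaEquiv (hf j k hj hk hjk)
      let z : (Δ[n] : SSet.{0}) _⦋n⦌ := SSet.yonedaEquiv (𝟙 _)
      exact (discrete_app_stdSimplex (f j hj) ((stdSimplex.δ _).app _ z)).symm.trans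
        (h.trans (discrete_app_stdSimplex (f k hk) ((stdSimplex.δ _).app _ z)))
  -- All faces being constant with the same value, the constant map with this value is a filler.
  obtain ⟨j₀, hj₀⟩ := exists_ne i
  let t : T := SSet.yonedaEquiv (f j₀ hj₀)
  refine ⟨{ app _ := ↾fun _ ↦ t }, fun j hj ↦ ?_⟩
  ext m x
  refine Eq.trans ?_ (discrete_app_stdSimplex (f j hj) x).symm
  change SSet.yonedaEquiv (f j₀ hj₀) = _
  rcases lt_trichotomy j₀ j with h | rfl | h
  · exact key _ _ _ _ h
  · rfl
  · exact (key _ _ _ _ h).symm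

/-- The vertex `i` of a simplex. -/
def simplexVertex {X : SSet.{0}} {n : SimplexCategoryᵒᵖ} (x : X.obj n) (i : Fin (n.unop.len + 1)) :
    X _⦋0⦌ :=
  X.map (SimplexCategory.const ⦋0⦌ n.unop i).op x

lemma simplexVertex_map {X : SSet.{0}} {n m : SimplexCategoryᵒᵖ} (φ : n ⟶ m) (x : X.obj n)
    (i : Fin (m.unop.len + 1)) :
    simplexVertex (X.map φ x) i = simplexVertex x (φ.unop.toOrderHom i) := by
  unfold simplexVertex
  rw [← ConcreteCategory.comp_apply, ← X.map_comp]
  rfl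

lemma simplexVertex_app {X Y : SSet.{0}} (f : X ⟶ Y) {n : SimplexCategoryᵒᵖ} (x : X.obj n)
    (i : Fin (n.unop.len + 1)) :
    simplexVertex (f.app n x) i = f.app _ (simplexVertex x i) :=
  (ConcreteCategory.congr_hom (f.naturality _) x).symm

@[simp]
lemma simplexVertex_zero {X : SSet.{0}} (x : X _⦋0⦌) (i : Fin 1) : simplexVertex x i = x := by
  obtain rfl : i = 0 := Subsingleton.elim _ _
  refine (ConcreteCategory.congr_hom (congr_arg X.map (congr_arg Quiver.Hom.op
    (SimplexCategory.const_eq_id))) x).trans ?_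
  exact ConcreteCategory.congr_hom (X.map_id _) x

lemma π₀_mk_simplexVertex_of_le {X : SSet.{0}} {n : SimplexCategoryᵒᵖ} (x : X.obj n)
    {i j : Fin (n.unop.len + 1)} (h : i ≤ j) :
    π₀.mk (simplexVertex x i) = π₀.mk (simplexVertex x j) := by
  refine π₀.sound (Edge.mk (X.map (SimplexCategory.mkOfLe i j h).op x) ?_ ?_)
  · change X.map _ (X.map _ x) = X.map _ x
    rw [← ConcreteCategory.comp_apply, ← X.map_comp, ← op_comp]
    congr 3
    refine Quiver.Hom.unop_inj ?_
    ext k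
    fin_cases k
    rfl
  · change X.map _ (X.map _ x) = X.map _ x
    rw [← ConcreteCategory.comp_apply, ← X.map_comp, ← op_comp]
    congr 3
    refine Quiver.Hom.unop_inj ?_
    ext k
    fin_cases k
    rfl

/-- The canonical map from a simplicial set to the discrete simplicial set of its connected
components, sending a simplex to the component of its vertices. -/
def toComponents : 𝟭 SSet.{0} ⟶ π₀Functor ⋙ discrete where
  app X :=
    { app n := ↾fun x ↦ π₀.mk (simplexVertex x 0)
      naturality n m g := by
        ext x
        change π₀.mk (simplexVertex (X.map g x) 0) = π₀.mk (simplexVertex x 0)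
        rw [simplexVertex_map]
        exact (π₀_mk_simplexVertex_of_le x (Fin.zero_le _)).symm }
  naturality X Y f := by
    ext n x
    exact congr_arg π₀.mk (simplexVertex_app f x 0)

/-- The function on connected components induced by a map to a discrete simplicial set. -/
def componentsDesc {X : SSet.{0}} {T : Type} (g : X ⟶ discrete.obj T) : π₀ X → T :=
  π₀.lift (fun x ↦ g.app (op ⦋0⦌) x) (fun x y e ↦ by
    have h₁ := congr_arg (fun z ↦ (g.app (op ⦋0⦌) z : T)) e.src_eq
    have h₀ := congr_arg (fun z ↦ (g.app (op ⦋0⦌) z : T)) e.tgt_eq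
    exact h₁.symm.trans ((discrete_app_map g (SimplexCategory.δ 1).op e.edge).trans
      ((discrete_app_map g (SimplexCategory.δ 0).op e.edge).symm.trans h₀)))

lemma discrete_hom_ext {X : SSet.{0}} {T : Type} {f g : X ⟶ discrete.obj T}
    (h : ∀ x : X _⦋0⦌, (f.app _ x : T) = g.app _ x) : f = g := by
  ext n x
  exact (discrete_app_map f (SimplexCategory.const ⦋0⦌ n.unop 0).op x).symm.trans
    ((h _).trans (discrete_app_map g _ x))

/-- Homotopic maps to a discrete simplicial set are equal: the degenerate edge at a vertex `x`,
paired with the nondegenerate edge of `Δ[1]`, joins the two ends of the homotopy over `x`. -/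
lemma eq_of_homotopy_discrete {X : SSet.{0}} {T : Type} {f g : X ⟶ discrete.obj T}
    (H : SSet.Homotopy f g) : f = g := by
  refine discrete_hom_ext fun x ↦ ?_
  let e : (X ⊗ Δ[1]) _⦋1⦌ := (X.σ 0 x, SSet.yonedaEquiv (𝟙 Δ[1]))
  have h (i : Fin 2) := discrete_app_map H.h (SimplexCategory.δ i).op e
  have h₀ := ConcreteCategory.congr_hom (NatTrans.congr_app H.h₀ (op ⦋0⦌)) x
  have h₁ := ConcreteCategory.congr_hom (NatTrans.congr_app H.h₁ (op ⦋0⦌)) x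
  refine h₀.symm.trans (Eq.trans ?_ h₁)
  have e₀ : (X ⊗ Δ[1]).map (SimplexCategory.δ (1 : Fin 2)).op e = ι₀.app _ x := by
    refine Prod.ext ?_ ?_
    · exact ConcreteCategory.congr_hom (X.δ_comp_σ_succ (i := (0 : Fin 1))) x
    · exact (stdSimplex.objEquiv (n := ⦋1⦌) (m := op ⦋0⦌)).injective
        (by ext k; fin_cases k; rfl)
  have e₁ : (X ⊗ Δ[1]).map (SimplexCategory.δ (0 : Fin 2)).op e = ι₁.app _ x := by
    refine Prod.ext ?_ ?_
    · exact ConcreteCategory.congr_hom (X.δ_comp_σ_self (i := (0 : Fin 1))) x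
    · exact (stdSimplex.objEquiv (n := ⦋1⦌) (m := op ⦋0⦌)).injective
        (by ext k; fin_cases k; rfl)
  have := (h 1).trans (h 0).symm
  rw [e₀, e₁] at this
  exact this

lemma eq_of_homotopyClasses_discrete {X : SSet.{0}} {T : Type} {f g : X ⟶ discrete.obj T}
    (h : (Quot.mk _ f : HomotopyClasses X (discrete.obj T)) = Quot.mk _ g) : f = g :=
  congr_arg (Quot.lift id fun _ _ ⟨H⟩ ↦ eq_of_homotopy_discrete H) h

/-- Weak equivalences, being detected by all Kan complexes, are in particular detected by the
discrete ones, hence induce bijections on connected components. -/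
lemma isIso_π₀Functor_map {X Y : SSet.{0}} (f : X ⟶ Y) (hf : weakEquivalences f) :
    IsIso (π₀Functor.map f) := by
  obtain ⟨⟨g⟩, hg⟩ := (hf (discrete.obj (π₀ X))).2 (Quot.mk _ (toComponents.app X))
  replace hg : f ≫ g = toComponents.app X := eq_of_homotopyClasses_discrete hg
  have hg' : g ≫ discrete.map (π₀Functor.map f) = toComponents.app Y := by
    refine eq_of_homotopyClasses_discrete ((hf (discrete.obj (π₀ Y))).1 ?_)
    change Quot.mk _ (f ≫ g ≫ discrete.map (π₀Functor.map f)) = Quot.mk _ (f ≫ toComponents.app Y)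
    rw [reassoc_of% hg]
    exact congr_arg _ (toComponents.naturality f).symm
  refine ⟨↾componentsDesc g, ?_, ?_⟩
  · ext (x : π₀ X)
    induction x with | mk x
    refine (ConcreteCategory.congr_hom (NatTrans.congr_app hg (op ⦋0⦌)) x).trans ?_
    exact congr_arg π₀.mk (simplexVertex_zero x 0)
  · ext (y : π₀ Y)
    induction y with | mk y
    refine (ConcreteCategory.congr_hom (NatTrans.congr_app hg' (op ⦋0⦌)) y).trans ?_
    exact congr_arg π₀.mk (simplexVertex_zero y 0)

/-- A retraction onto a simplicial set, with a section that is a homotopy inverse, is a weak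
equivalence. -/
lemma weakEquivalences_of_section {X Y : SSet.{0}} (r : X ⟶ Y) (s : Y ⟶ X) (hs : s ≫ r = 𝟙 Y)
    (H : SSet.Homotopy (𝟙 X) (r ≫ s)) : weakEquivalences r := by
  intro Z _
  constructor
  · refine Function.LeftInverse.injective (g := HomotopyClasses.precomp s Z) ?_
    rintro ⟨g⟩
    change Quot.mk _ (s ≫ r ≫ g) = Quot.mk _ g
    rw [reassoc_of% hs]
  · rintro ⟨g⟩
    refine ⟨Quot.mk _ (s ≫ g), Eq.symm ?_⟩
    change Quot.mk _ g = Quot.mk _ (r ≫ s ≫ g)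
    exact Quot.sound ⟨SSet.RelativeMorphism.Homotopy.postcomp H
      (SSet.RelativeMorphism.botEquiv.symm g)
      (Limits.IsInitial.hom_ext SSet.Subcomplex.isInitialBot _ _)⟩

/-! ### Nerves of preordered sets -/

section Nerve

variable {P : Type} [Preorder P]

lemma nerve_obj_le {n : SimplexCategoryᵒᵖ} (x : (nerve P).obj n) {i j : Fin (n.unop.len + 1)}
    (h : i ≤ j) : x.obj i ≤ x.obj j :=
  leOfHom (x.map (homOfLE h))

/-- Two maps to the nerve of a preordered set that are comparable on vertices are homotopic. -/
def nerveHomotopy {X : SSet.{0}} (f g : X ⟶ nerve P)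
    (h : ∀ x : X _⦋0⦌, (f.app _ x).obj 0 ≤ (g.app _ x).obj 0) : SSet.Homotopy f g := by
  have h' {n : SimplexCategoryᵒᵖ} (x : X.obj n) (i : Fin (n.unop.len + 1)) :
      (f.app n x).obj i ≤ (g.app n x).obj i := by
    have := h (simplexVertex x i)
    rw [← simplexVertex_app, ← simplexVertex_app] at this
    exact this
  have hmono {n : SimplexCategoryᵒᵖ} (x : X.obj n) (t : n.unop ⟶ ⦋1⦌) :
      Monotone (fun i : Fin (n.unop.len + 1) ↦
        if t.toOrderHom i = 0 then (f.app n x).obj i else (g.app n x).obj i) := by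
    intro i j hij
    have ht := t.toOrderHom.monotone hij
    dsimp only
    split_ifs with hi hj hj
    · exact nerve_obj_le _ hij
    · exact (h' x i).trans (nerve_obj_le _ hij)
    · exact absurd (hj ▸ ht) (by simpa using hi)
    · exact nerve_obj_le _ hij
  refine SSet.RelativeMorphism.Homotopy.mk
    { app n := ↾fun y ↦ (hmono y.1 (stdSimplex.objEquiv y.2)).functor
      naturality n m φ := ?_ } ?_ ?_ ?_
  · ext y i
    have hf : (f.app m (X.map φ y.1)).obj i = (f.app n y.1).obj (φ.unop.toOrderHom i) :=
      congr_arg (fun z : (nerve P).obj m ↦ z.obj i)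
        (ConcreteCategory.congr_hom (f.naturality φ) y.1)
    have hg : (g.app m (X.map φ y.1)).obj i = (g.app n y.1).obj (φ.unop.toOrderHom i) :=
      congr_arg (fun z : (nerve P).obj m ↦ z.obj i)
        (ConcreteCategory.congr_hom (g.naturality φ) y.1)
    exact congr_arg₂ (fun a b ↦ if (stdSimplex.objEquiv y.2).toOrderHom
      (φ.unop.toOrderHom i) = 0 then a else b) hf hg
  · ext n x i
    rfl
  · ext n x i
    rfl
  · ext n y i
    exact y.1.2.elim

/-- If every connected component of a preordered set `P` has a greatest element, then the nerve of
`P` is equivalent to its set of components. As `P` need not be antisymmetric, there may be several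
such elements. -/
lemma weakEquivalences_toComponents_nerve
    (h : ∀ c : π₀ (nerve P), ∃ m, π₀.mk (nerveEquiv.symm m) = c ∧
      ∀ v, π₀.mk (nerveEquiv.symm v) = c → v ≤ m) :
    weakEquivalences (toComponents.app (nerve P)) := by
  choose m hm hle using h
  let s : discrete.obj (π₀ (nerve P)) ⟶ nerve P :=
    { app n := ↾fun c ↦ (Functor.const _).obj (m c)
      naturality _ _ _ := rfl }
  refine weakEquivalences_of_section _ s ?_ (nerveHomotopy _ _ ?_)
  · refine discrete_hom_ext fun c ↦ ?_
    refine Eq.trans (congr_arg π₀.mk ?_) (hm c)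
    exact nerve.ext_of_isThin rfl
  · intro x
    refine hle _ _ ?_
    refine congr_arg π₀.mk ?_
    refine Eq.trans ?_ (simplexVertex_zero x 0).symm
    exact nerveEquiv.symm_apply_apply (show ComposableArrows P 0 from x)

end Nerve

/-! ### Morphisms in a localization -/

/-- Let `G` be a functor inverting `W`, with a functor `D` in the other direction and a natural
transformation `η : 𝟭 ⟶ G ⋙ D`. If `η` is invertible at `Y` after localization, then morphisms to
`Y` in the localization are determined by their images under the extension of `G`. -/
lemma localization_hom_ext {C E L' : Type*} [Category* C] [Category* E] [Category* L']
    (W : MorphismProperty C) (L : C ⥤ L') [L.IsLocalization W] (G : C ⥤ E)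
    (hG : W.IsInvertedBy G) (D : E ⥤ C) (η : 𝟭 C ⟶ G ⋙ D) {X Y : C} (hY : IsIso (L.map (η.app Y)))
    {u v : L.obj X ⟶ L.obj Y}
    (h : (Localization.lift G hG L).map u = (Localization.lift G hG L).map v) : u = v := by
  -- The extension of `η` to the localization; its naturality squares recover `u` from its image.
  let τ : 𝟭 L' ⟶ Localization.lift G hG L ⋙ D ⋙ L :=
    Localization.liftNatTrans L W L (G ⋙ D ⋙ L) _ _ (Functor.whiskerRight η L)
  have : IsIso (τ.app (L.obj Y)) := by
    rw [Localization.liftNatTrans_app]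
    have : IsIso ((Functor.whiskerRight η L).app Y) := hY
    infer_instance
  rw [← cancel_mono (τ.app (L.obj Y))]
  have hu := τ.naturality u
  have hv := τ.naturality v
  dsimp only [Functor.id_map, Functor.comp_map] at hu hv
  rw [hu, hv, h]

/-! ### Morphisms of diagrams and connected components -/

section Components

variable {C : Type} [Category.{0} C]

/-- The sets of connected components of a diagram of simplicial sets. -/
abbrev componentsFunctor (C : Type) [Category.{0} C] : (C ⥤ SSet.{0}) ⥤ (C ⥤ Type) :=
  (Functor.whiskeringRight C SSet.{0} Type).obj π₀Functor

lemma componentsFunctor_isInvertedBy :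
    (weakEquivalences.functorCategory C).IsInvertedBy (componentsFunctor C) := by
  intro X Y f hf
  have (c : C) : IsIso (((componentsFunctor C).map f).app c) := isIso_π₀Functor_map _ (hf c)
  exact NatIso.isIso_of_isIso_app _

/-- The map on sets of connected components induced by a morphism of `Fun(C, 𝐒)`. -/
noncomputable def homComponents {X Y : C ⥤ SSet.{0}} (u : (toHoFun C).obj X ⟶ (toHoFun C).obj Y) :
    X ⋙ π₀Functor ⟶ Y ⋙ π₀Functor :=
  let e := Localization.fac (componentsFunctor C) componentsFunctor_isInvertedBy (toHoFun C)
  e.inv.app X ≫ (Localization.lift (componentsFunctor C) componentsFunctor_isInvertedBy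
    (toHoFun C)).map u ≫ e.hom.app Y

lemma homComponents_map {X Y : C ⥤ SSet.{0}} (f : X ⟶ Y) :
    homComponents ((toHoFun C).map f) = Functor.whiskerRight f π₀Functor := by
  let e := Localization.fac (componentsFunctor C) componentsFunctor_isInvertedBy (toHoFun C)
  exact NatIso.naturality_1 e f

lemma homComponents_map_comp {X Y Z : C ⥤ SSet.{0}} (f : X ⟶ Y)
    (u : (toHoFun C).obj Y ⟶ (toHoFun C).obj Z) :
    homComponents ((toHoFun C).map f ≫ u) =
      Functor.whiskerRight f π₀Functor ≫ homComponents u := by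
  rw [← homComponents_map]
  simp [homComponents]

/-- If the diagram `Y` is objectwise equivalent to its diagram of connected components, then
morphisms to `Y` in `Fun(C, 𝐒)` are determined by their effect on connected components. -/
lemma hom_ext_of_components {X Y : C ⥤ SSet.{0}}
    (hY : ∀ c, weakEquivalences (toComponents.app (Y.obj c)))
    {u v : (toHoFun C).obj X ⟶ (toHoFun C).obj Y} (h : homComponents u = homComponents v) :
    u = v := by
  let η : 𝟭 (C ⥤ SSet.{0}) ⟶ componentsFunctor C ⋙ (Functor.whiskeringRight C _ _).obj discrete :=
    { app Z := Functor.whiskerLeft Z toComponents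
      naturality Z Z' f := by
        ext c : 2
        exact toComponents.naturality (f.app c) }
  refine localization_hom_ext (weakEquivalences.functorCategory C) (toHoFun C)
    (componentsFunctor C) componentsFunctor_isInvertedBy _ η ?_ ?_
  · exact Localization.inverts (toHoFun C) (weakEquivalences.functorCategory C) _ hY
  · exact (cancel_mono _).1 ((cancel_epi _).1 h)

/-- A diagram of spaces that is objectwise equivalent to its diagram of connected components, the
latter having no endomorphisms other than the identity, has no endomorphisms other than the
identity. -/
lemma end_eq_id {D : C ⥤ SSet.{0}}
    (hD : ∀ c, weakEquivalences (toComponents.app (D.obj c)))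
    (hEnd : ∀ θ : D ⋙ π₀Functor ⟶ D ⋙ π₀Functor, θ = 𝟙 _)
    (u : (toHoFun C).obj D ⟶ (toHoFun C).obj D) : u = 𝟙 _ :=
  hom_ext_of_components hD ((hEnd _).trans (hEnd _).symm)

/-- The components of `K × D` are covered by those of the copies of `D` at the vertices of `K`. -/
lemma tensor_components_hom_ext {K : SSet.{0}} {D : C ⥤ SSet.{0}} {T : C ⥤ Type}
    {f g : tensor K D ⋙ π₀Functor ⟶ T}
    (h : ∀ k : K _⦋0⦌, Functor.whiskerRight (tensorVertex k D) π₀Functor ≫ f =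
      Functor.whiskerRight (tensorVertex k D) π₀Functor ≫ g) : f = g := by
  ext c (x : π₀ (K ⊗ D.obj c))
  induction x with | mk x
  obtain ⟨k, d⟩ := x
  have := ConcreteCategory.congr_hom (NatTrans.congr_app (h k) c) (π₀.mk d)
  have hx : ((tensorVertex k D).app c).app _ d = ((k, d) : (K ⊗ D.obj c) _⦋0⦌) :=
    Prod.ext (simplexVertex_zero k 0) rfl
  change f.app c (π₀.mk _) = g.app c (π₀.mk _) at this
  rwa [hx] at this

/-- The contractibility condition on families holds as soon as the diagram of connected components
has no endomorphism but the identity. -/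
lemma autSpaceIsContractible_of_end {D : C ⥤ SSet.{0}}
    (hD : ∀ c, weakEquivalences (toComponents.app (D.obj c)))
    (hEnd : ∀ θ : D ⋙ π₀Functor ⟶ D ⋙ π₀Functor, θ = 𝟙 _) : AutSpaceIsContractible D := by
  rintro K ⟨φ, hφ⟩
  suffices φ = (toHoFun C).map (tensorProj K D) by subst this; rfl
  refine hom_ext_of_components hD (tensor_components_hom_ext fun k ↦ ?_)
  rw [← homComponents_map_comp, ← homComponents_map_comp, hEnd (homComponents _)]
  exact (hEnd _).symm

end Components

/-! ### The connected components of `F(σ)` -/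

lemma Obj.of_inj {σ : SimplicesAss} {i i' : Fin (dim σ + 1)} {p : Pt (vertex σ i)}
    {p' : Pt (vertex σ i')} (h : Obj.of σ i p = Obj.of σ i' p') :
    ∃ hi : i = i', p'= hi ▸ p := by
  obtain ⟨a, b⟩ := p
  obtain ⟨a', b'⟩ := p'
  simp only [Obj.of, Obj.mk.injEq] at h
  obtain ⟨rfl, h2, rfl⟩ := h
  obtain rfl := eq_of_heq h2
  exact ⟨rfl, rfl⟩

/-- Two segments of `[n]` over a common segment `e` of `[m]` are equal. -/
lemma segment_over_unique {n m : SimplexCategory} (f : n ⟶ m) {j j' : Fin n.len} {e : ℕ}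
    (h₁ : (f.toOrderHom j.castSucc : ℕ) ≤ e) (h₂ : e < f.toOrderHom j.succ)
    (h₁' : (f.toOrderHom j'.castSucc : ℕ) ≤ e) (h₂' : e < f.toOrderHom j'.succ) : j = j' := by
  by_contra hne
  rcases lt_or_gt_of_ne hne with h | h
  · have : (f.toOrderHom j.succ : ℕ) ≤ f.toOrderHom j'.castSucc :=
      f.toOrderHom.monotone (Fin.succ_le_castSucc_iff.2 h)
    omega
  · have : (f.toOrderHom j'.succ : ℕ) ≤ f.toOrderHom j.castSucc :=
      f.toOrderHom.monotone (Fin.succ_le_castSucc_iff.2 h)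
    omega

/-- An arrow is determined by its source. -/
lemma arc_rightUnique {n m : SimplexCategory} (f : n ⟶ m) {p q q' : Pt m ⊕ Pt n}
    (h : Arc f p q) (h' : Arc f p q') : q = q' := by
  cases h with
  | up j e he hlt =>
    cases h' with
    | up _ e' he' hlt' => rw [Fin.ext (he.trans he'.symm)]
    | unit _ h => rw [Fin.ext_iff] at h; omega
  | across j e e₁ he hee hlt =>
    cases h' with
    | across j' _ e₁' he' hee' hlt' => rw [Fin.ext (hee.trans hee'.symm)]
    | down j' _ he' hlt' =>
      obtain rfl := segment_over_unique f (e := e) he (by omega) he' (by omega)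
      omega
  | down j e he hlt =>
    cases h' with
    | across j' _ e₁' he' hee' hlt' =>
      obtain rfl := segment_over_unique f (e := e) he (by omega) he' (by omega)
      omega
    | down j' _ he' hlt' =>
      obtain rfl := segment_over_unique f (e := e) he (by omega) he' (by omega)
      rfl
  | unit j h =>
    cases h' with
    | up _ e' he' hlt' => rw [Fin.ext_iff] at h; omega
    | unit _ h => rfl

/-- Arrows with a source labelled `𝐱` start in the bottom row, those with a source labelled `𝐲`
start in the top row. -/
lemma arc_source {n m : SimplexCategory} {f : n ⟶ m} {p q : Pt m ⊕ Pt n} (h : Arc f p q) :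
    (∃ j, p = .inr (j, .x)) ∨ ∃ e, p = .inl (e, .y) := by
  cases h <;> simp

lemma step_rightUnique {σ : SimplicesAss} {u v w : Obj σ} (h : Step σ u v) (h' : Step σ u w) :
    v = w := by
  obtain ⟨i, p, q, h⟩ := h
  generalize hu : p.elim _ _ = u at h'
  obtain ⟨i', p', q', h'⟩ := h'
  have key : ∃ hi : i = i', p' = hi ▸ p := by
    rcases arc_source h with ⟨j, rfl⟩ | ⟨j, rfl⟩ <;>
      rcases arc_source h' with ⟨j', rfl⟩ | ⟨j', rfl⟩
    · obtain ⟨hi, hp⟩ := Obj.of_inj hu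
      obtain rfl := Fin.succ_injective _ hi
      cases hp
      exact ⟨rfl, rfl⟩
    · cases congr_arg Obj.label hu
    · cases congr_arg Obj.label hu
    · obtain ⟨hi, hp⟩ := Obj.of_inj hu
      obtain rfl := Fin.castSucc_injective _ hi
      cases hp
      exact ⟨rfl, rfl⟩
  obtain ⟨rfl, rfl⟩ := key
  rw [arc_rightUnique _ h h']

instance : Finite Label :=
  Finite.of_injective (fun l ↦ l = .x) (by rintro (_ | _) (_ | _) h <;> simp_all)

instance (σ : SimplicesAss) : Finite (Obj σ) :=
  Finite.of_injective (fun v ↦ (⟨v.level, v.seg, v.label⟩ : Σ i, Pt (vertex σ i))) (by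
    rintro ⟨i, s, l⟩ ⟨i', s', l'⟩ h
    cases h
    rfl)

/-- The connected component in `BF(σ)` of a point of `F(σ)`. -/
def component {σ : SimplicesAss} (v : Obj σ) : (BF ⋙ π₀Functor).obj σ :=
  (π₀.mk (nerveEquiv.symm v : ComposableArrows (Obj σ) 0) : π₀ (nerve (Obj σ)))

lemma component_surjective {σ : SimplicesAss} : Function.Surjective (component (σ := σ)) :=
  fun c ↦ by
    obtain ⟨x, rfl⟩ := π₀.mk_surjective (X := nerve (Obj σ)) c
    exact ⟨nerveEquiv x, congr_arg _ (nerveEquiv.symm_apply_apply _)⟩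

lemma component_map {σ τ : SimplicesAss} (α : σ ⟶ τ) (v : Obj σ) :
    (BF ⋙ π₀Functor).map α (component v) = component (Obj.map α v) :=
  congr_arg (π₀.mk (X := nerve (Obj τ))) (nerve.ext_of_isThin (C := Obj τ) rfl)

lemma component_eq_of_step {σ : SimplicesAss} {v w : Obj σ} (h : Step σ v w) :
    component v = component w :=
  π₀.sound (X := nerve (Obj σ)) (nerve.edgeMk (homOfLE (Relation.ReflTransGen.single h)))

/-- A function on points that is constant along the arrows of the graph is constant on
connected components. -/
lemma eq_of_component_eq {σ : SimplicesAss} {T : Type} (I : Obj σ → T)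
    (hI : ∀ v w, Step σ v w → I v = I w) {v w : Obj σ} (h : component v = component w) :
    I v = I w := by
  have hle (a b : Obj σ) (hab : a ≤ b) : I a = I b := by
    induction hab with
    | refl => rfl
    | tail _ hs ih => exact ih.trans (hI _ _ hs)
  exact congr_arg (π₀.lift (X := nerve (Obj σ)) (fun x ↦ I (nerveEquiv x))
    fun x y e ↦ hle _ _ (leOfHom (nerve.homEquiv e))) h

/-- Points in the same connected component have a common upper bound: the arrows out of a point
are unique, so two paths out of a point are comparable. -/
lemma exists_le_of_component_eq {σ : SimplicesAss} {v w : Obj σ}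
    (h : component v = component w) : ∃ m, v ≤ m ∧ w ≤ m := by
  have hJ : Equivalence (Relation.Join (Relation.ReflTransGen (Step σ))) :=
    Relation.equivalence_join_reflTransGen fun a b c hb hc ↦
      ⟨b, .refl, by rw [step_rightUnique hb hc]⟩
  let S : Setoid (Obj σ) := ⟨_, hJ⟩
  exact Quotient.exact (eq_of_component_eq (Quotient.mk S)
    (fun a b hab ↦ Quotient.sound ⟨b, .single hab, .refl⟩) h)

lemma weakEquivalences_toComponents_BF (σ : SimplicesAss) :
    weakEquivalences (toComponents.app (BF.obj σ)) := by
  refine weakEquivalences_toComponents_nerve (P := Obj σ) fun c ↦ ?_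
  obtain ⟨v₀, hv₀⟩ := component_surjective (σ := σ) c
  let S := { v : Obj σ // component v = c }
  have : Nonempty S := ⟨v₀, hv₀⟩
  have : IsDirectedOrder S := ⟨fun a b ↦ by
    obtain ⟨m, ham, hbm⟩ := exists_le_of_component_eq (a.2.trans b.2.symm)
    refine ⟨⟨m, Eq.trans ?_ a.2⟩, ham, hbm⟩
    exact (π₀.sound (X := nerve (Obj σ)) (nerve.edgeMk (homOfLE ham))).symm⟩
  obtain ⟨m, hm⟩ := Finite.exists_le (id : S → S)
  exact ⟨m.1, m.2, fun v hv ↦ hm ⟨v, hv⟩⟩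

/-! ### Simplices of dimension zero and one -/

/-- The 0-simplex `[n]` of `Ass`. -/
def point (n : SimplexCategory) : SimplicesAss :=
  CostructuredArrow.mk (Y := ⦋0⦌) (Functor.toCatHom ((Functor.const (Fin 1)).obj (op n)))

/-- The 1-simplex of `Ass` attached to a map `f : [n] ⟶ [m]` of `Δ`. Its vertex `0` is `[m]` and
its vertex `1` is `[n]`. -/
def segment {n m : SimplexCategory} (f : n ⟶ m) : SimplicesAss :=
  CostructuredArrow.mk (Y := ⦋1⦌) (Functor.toCatHom (ComposableArrows.mk₁ f.op))

/-- The inclusion of the vertex `i` of a simplex. -/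
def vertexHom (σ : SimplicesAss) (i : Fin (dim σ + 1)) : point (vertex σ i) ⟶ σ :=
  CostructuredArrow.homMk (SimplexCategory.const ⦋0⦌ σ.left i) (by
    refine congr_arg Functor.toCatHom (CategoryTheory.Functor.ext (fun _ ↦ rfl) fun _ _ _ ↦ ?_)
    exact congr_arg _ (Subsingleton.elim (α := (_ : Fin (dim σ + 1)) ⟶ _) _ (𝟙 _)) |>.trans
      ((σ.hom.toFunctor.map_id i).trans (by simp; rfl)))

/-- An element of `Pt n`, as a point of `F` of the 0-simplex `[n]`. -/
def pt {n : SimplexCategory} (p : Pt n) : Obj (point n) := Obj.of (point n) 0 p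

lemma exists_eq_pt {n : SimplexCategory} (v : Obj (point n)) : ∃ p : Pt n, v = pt p := by
  obtain ⟨i, s, l⟩ := v
  obtain rfl := Subsingleton.elim (α := Fin 1) i 0
  exact ⟨(s, l), rfl⟩

lemma map_vertexHom (σ : SimplicesAss) (i : Fin (dim σ + 1)) (p : Pt (vertex σ i)) :
    Obj.map (vertexHom σ i) (pt p) = Obj.of σ i p := rfl

/-- The points of the vertex `0` of a 1-simplex. -/
def top {n m : SimplexCategory} (f : n ⟶ m) (p : Pt m) : Obj (segment f) :=
  Obj.of (segment f) (0 : Fin 2) p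

/-- The points of the vertex `1` of a 1-simplex. -/
def bot {n m : SimplexCategory} (f : n ⟶ m) (p : Pt n) : Obj (segment f) :=
  Obj.of (segment f) (1 : Fin 2) p

lemma step_segment {n m : SimplexCategory} (f : n ⟶ m) {p q} (h : Arc f p q) :
    Step (segment f) (p.elim (top f) (bot f)) (q.elim (top f) (bot f)) :=
  Step.mk (σ := segment f) (0 : Fin 1) p q h

/-- A function on `Pt m` and a function on `Pt n` that are compatible with the arrows attached to
`f` agree on points of the two rows that lie in the same connected component. -/
lemma segment_eq_of_component_eq {n m : SimplexCategory} (f : n ⟶ m) {T : Type}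
    (I₀ : Pt m → T) (I₁ : Pt n → T)
    (hI : ∀ p q, Arc f p q → p.elim I₀ I₁ = q.elim I₀ I₁) {p : Pt m} {q : Pt n}
    (h : component (top f p) = component (bot f q)) : I₀ p = I₁ q := by
  let I : Obj (segment f) → T := fun v ↦ match v with
    | ⟨⟨0, _⟩, s, l⟩ => I₀ (s, l)
    | ⟨⟨1, _⟩, s, l⟩ => I₁ (s, l)
  have hI' (p : Pt m ⊕ Pt n) : I (p.elim (top f) (bot f)) = p.elim I₀ I₁ := by
    rcases p with p | p <;> rfl
  refine eq_of_component_eq I ?_ h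
  rintro _ _ ⟨i, p, q, hpq⟩
  obtain rfl := Subsingleton.elim (α := Fin 1) i 0
  exact (hI' p).trans ((hI p q hpq).trans (hI' q).symm)

/-- The end of a segment at which a point is located: the initial vertex for `𝐱`, the final
vertex for `𝐲`. -/
def endpoint {n : SimplexCategory} (p : Pt n) : Fin (n.len + 1) :=
  match p.2 with
  | .x => p.1.castSucc
  | .y => p.1.succ

/-- The arrows attached to `f` preserve the position of endpoints in the top row. -/
lemma endpoint_eq_of_component_eq {n m : SimplexCategory} (f : n ⟶ m) {p : Pt m} {q : Pt n}
    (h : component (top f p) = component (bot f q)) : endpoint p = f.toOrderHom (endpoint q) := by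
  refine segment_eq_of_component_eq f endpoint (fun q ↦ f.toOrderHom (endpoint q)) ?_ h
  intro p q h
  cases h with
  | up j e he hlt => exact Fin.ext he.symm
  | across j e e' he hee' hlt => exact Fin.ext hee'.symm
  | down j e he hlt => exact Fin.ext hlt
  | unit j h => exact h

/-- The inclusion `[1] ⟶ [n]` of the segment `j`. -/
def inert {n : SimplexCategory} (j : Fin n.len) : ⦋1⦌ ⟶ n :=
  SimplexCategory.mkOfLe j.castSucc j.succ j.castSucc_le_succ

/-- The points attached to `[n]` form a retract of those attached to the inclusion of a segment. -/
lemma eq_of_component_eq_inert {n : SimplexCategory} {j : Fin n.len} {p : Pt n} {l : Label}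
    (h : component (top (inert j) p) = component (bot (inert j) (0, l))) : p = (j, l) := by
  refine segment_eq_of_component_eq (inert j) id (fun q ↦ (j, q.2)) ?_ h
  intro p q h
  cases h with
  | up i e he hlt =>
    obtain rfl := Subsingleton.elim (α := Fin 1) i 0
    exact Prod.ext (Fin.ext he.symm) rfl
  | across i e e' he hee' hlt =>
    -- The image of an inert map has a single segment, hence no consecutive ones.
    obtain rfl := Subsingleton.elim (α := Fin 1) i 0
    change (j : ℕ) ≤ e at he
    change (e' : ℕ) < j + 1 at hlt
    omega
  | down i e he hlt =>
    obtain rfl := Subsingleton.elim (α := Fin 1) i 0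
    exact Prod.ext (Fin.ext (Nat.succ.inj hlt)) rfl
  | unit i h =>
    obtain rfl := Subsingleton.elim (α := Fin 1) i 0
    have h : (j : ℕ) = j + 1 := congr_arg Fin.val h
    omega

lemma component_top_inert {n : SimplexCategory} (j : Fin n.len) (l : Label) :
    component (top (inert j) (j, l)) = component (bot (inert j) (0, l)) := by
  cases l
  · exact (component_eq_of_step
      (step_segment _ (.up (0 : Fin 1) j rfl (Nat.lt_succ_self _)))).symm
  · exact component_eq_of_step (step_segment _ (.down (0 : Fin 1) j le_rfl rfl))

/-- The map `[1] ⟶ [2]` onto the first and last vertices. -/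
def active : (⦋1⦌ : SimplexCategory) ⟶ ⦋2⦌ :=
  SimplexCategory.mkOfLe 0 2 (Fin.zero_le _)

lemma component_top_active_x :
    component (top active ((0 : Fin 2), .x)) = component (bot active ((0 : Fin 1), .x)) :=
  (component_eq_of_step (step_segment active
    (.up (0 : Fin 1) (0 : Fin 2) rfl (Nat.succ_pos _)))).symm

lemma component_top_active_y :
    component (top active ((1 : Fin 2), .y)) = component (bot active ((0 : Fin 1), .y)) :=
  component_eq_of_step (step_segment active
    (.down (0 : Fin 1) (1 : Fin 2) (Nat.zero_le _) rfl))

/-! ### Endomorphisms of the diagram of connected components -/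

section Endomorphisms

variable (θ : BF ⋙ π₀Functor ⟶ BF ⋙ π₀Functor)

lemma app_component_of {σ : SimplicesAss} {i : Fin (dim σ + 1)} {p q : Pt (vertex σ i)}
    (h : θ.app _ (component (pt p)) = component (pt q)) :
    θ.app σ (component (Obj.of σ i p)) = component (Obj.of σ i q) := by
  rw [← map_vertexHom, ← component_map, ← map_vertexHom, ← component_map, ← h]
  exact ConcreteCategory.congr_hom (θ.naturality (vertexHom σ i)) (component (pt p))

lemma exists_app_component {n : SimplexCategory} (p : Pt n) :
    ∃ q : Pt n, θ.app _ (component (pt p)) = component (pt q) := by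
  obtain ⟨v, hv⟩ := component_surjective (θ.app _ (component (pt p)))
  obtain ⟨q, rfl⟩ := exists_eq_pt v
  exact ⟨q, hv.symm⟩

/-- An endomorphism is compatible with the identifications made by a 1-simplex. -/
lemma component_top_eq_bot {n m : SimplexCategory} (f : n ⟶ m) {p p' : Pt m} {q q' : Pt n}
    (h : component (top f p) = component (bot f q))
    (hp : θ.app _ (component (pt p)) = component (pt p'))
    (hq : θ.app _ (component (pt q)) = component (pt q')) :
    component (top f p') = component (bot f q') :=
  (app_component_of θ (σ := segment f) (i := (0 : Fin 2)) hp).symm.trans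
    ((congr_arg _ h).trans (app_component_of θ (σ := segment f) (i := (1 : Fin 2)) hq))

/-- An endomorphism fixes both points of `[1]`. -/
lemma app_component_one (l : Label) :
    θ.app (point ⦋1⦌) (component (pt ((0 : Fin 1), l))) = component (pt ((0 : Fin 1), l)) := by
  obtain ⟨⟨j, l'⟩, hl⟩ := exists_app_component θ (n := ⦋1⦌) ((0 : Fin 1), l)
  obtain rfl := Subsingleton.elim (α := Fin 1) j 0
  suffices l' = l by rw [hl, this]
  cases l <;> cases l'
  · rfl
  · exfalso
    -- The image of the first `𝐱` of `[2]` would have the endpoints `2` and `1`.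
    obtain ⟨p, hp⟩ := exists_app_component θ (n := ⦋2⦌) ((0 : Fin 2), .x)
    have h₁ := endpoint_eq_of_component_eq _
      (component_top_eq_bot θ active component_top_active_x hp hl)
    have h₂ := endpoint_eq_of_component_eq _
      (component_top_eq_bot θ _ (component_top_inert _ _) hp hl)
    exact absurd (congr_arg Fin.val (h₁.symm.trans h₂)) (show ¬ 2 = 1 by decide)
  · exfalso
    -- The image of the last `𝐲` of `[2]` would have the endpoints `0` and `1`.
    obtain ⟨p, hp⟩ := exists_app_component θ (n := ⦋2⦌) ((1 : Fin 2), .y)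
    have h₁ := endpoint_eq_of_component_eq _
      (component_top_eq_bot θ active component_top_active_y hp hl)
    have h₂ := endpoint_eq_of_component_eq _
      (component_top_eq_bot θ _ (component_top_inert _ _) hp hl)
    exact absurd (congr_arg Fin.val (h₁.symm.trans h₂)) (show ¬ 0 = 1 by decide)
  · rfl

lemma app_component_pt {n : SimplexCategory} (p : Pt n) :
    θ.app _ (component (pt p)) = component (pt p) := by
  obtain ⟨j, l⟩ := p
  obtain ⟨q, hq⟩ := exists_app_component θ (j, l)
  rw [hq, eq_of_component_eq_inert (component_top_eq_bot θ (inert j) (component_top_inert j l) hq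
    (app_component_one θ l))]

/-- The diagram of connected components of `BF` has no endomorphism but the identity. -/
lemma end_components_eq_id : θ = 𝟙 _ := by
  ext σ c
  obtain ⟨⟨i, s, l⟩, rfl⟩ := component_surjective (σ := σ) c
  exact app_component_of θ (app_component_pt θ (s, l))

end Endomorphisms

end HinichUnicity

open HinichUnicity in
/-- The automorphism group of `BF` in the ∞-category of functors from `Δ_Ass` to spaces is
trivial: every automorphism is (homotopic to) the identity, and the whole space of automorphisms
is contractible. -/
theorem mainTheorem3 :
    (∀ φ : Aut ((toHoFun SimplicesAss).obj BF), φ = 1) ∧ AutSpaceIsContractible BF :=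
  ⟨fun φ ↦ Iso.ext (end_eq_id weakEquivalences_toComponents_BF end_components_eq_id φ.hom),
    autSpaceIsContractible_of_end weakEquivalences_toComponents_BF end_components_eq_id⟩
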